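/- For a unital $C^*$-algebra $A$ and $a,b\in A$, say that $a$ is strong Birkhoff--James orthogonal to $b$ if $\|a+bc\|\ge\|a\|$ for all $c\in A$, and that $a$ and $b$ are mutually strong Birkhoff--James orthogonal if each is strong Birkhoff--James orthogonal to the other. The orthograph $\Gamma(A)$ has as vertices the nonzero elements of $A$ up to multiplication by nonzero complex scalars, two vertices being adjacent if they are mutually strong Birkhoff--James orthogonal (this does not depend on the representatives). Let $\operatorname{diam}(A)\in\{0,1,2,\dots,\infty\}$ denote the supremum of the graph distances between non-isolated vertices of $\Gamma(A)$, where two vertices that are not joined by a path have distance $\infty$. **Theorem.** Let $k\ge 2$, let $n_1,\dots,n_k\ge 1$ be integers, and let $A$ be a $C^*$-algebra that is $*$-isomorphic to $M_{n_1}(\mathbb C)\oplus\cdots\oplus M_{n_k}(\mathbb C)$. Then: 1. $\operatorname{diam}(A)=1$ if $A\cong\mathbb C\oplus\mathbb C$; 2. $\operatorname{diam}(A)=4$ if $A\cong\mathbb C\oplus M_2(\mathbb C)$; 3. $\operatorname{diam}(A)=3$ in all other cases. In particular, any two non-isolated vertices of $\Gamma(A)$ are joined by a path. -/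

import Mathlib

open scoped LinearAlgebra.Projectivization

/-- `a` is strong Birkhoff–James orthogonal to `b` in the C*-algebra `A` (seen as a right Hilbert
C*-module over itself): `‖a + b c‖ ≥ ‖a‖` for all `c ∈ A`. -/
def StrongBJ {A : Type*} [CStarAlgebra A] (a b : A) : Prop :=
  ∀ c : A, ‖a‖ ≤ ‖a + b * c‖

/-- `a` and `b` are mutually strong Birkhoff–James orthogonal. -/
def MutualStrongBJ {A : Type*} [CStarAlgebra A] (a b : A) : Prop :=
  StrongBJ a b ∧ StrongBJ b a

theorem MutualStrongBJ.symm {A : Type*} [CStarAlgebra A] {a b : A} (h : MutualStrongBJ a b) :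
    MutualStrongBJ b a :=
  ⟨h.2, h.1⟩

theorem MutualStrongBJ.eq_zero {A : Type*} [CStarAlgebra A] {a : A} (h : MutualStrongBJ a a) :
    a = 0 := by
  have h1 := h.1 (-1)
  simpa using h1

theorem StrongBJ.smul {A : Type*} [CStarAlgebra A] {a b : A} (h : StrongBJ a b)
    {s : ℂ} (hs : s ≠ 0) (t : ℂ) : StrongBJ (s • a) (t • b) := by
  intro c
  have h1 := h ((s⁻¹ * t) • c)
  have h2 : s • a + (t • b) * c = s • (a + b * ((s⁻¹ * t) • c)) := by
    rw [smul_add, mul_smul_comm, smul_smul, mul_inv_cancel_left₀ hs, smul_mul_assoc]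
  rw [h2, norm_smul, norm_smul]
  exact mul_le_mul_of_nonneg_left h1 (norm_nonneg s)

/-- The orthograph of `A`: its vertices are the points of the projective space `ℙ ℂ A` of nonzero
elements up to scalar multiples, and two vertices are joined when their representatives are mutually
strong Birkhoff–James orthogonal. The choice of representatives does not matter, see
`orthograph_adj_mk`. -/
def orthograph (A : Type*) [CStarAlgebra A] : SimpleGraph (ℙ ℂ A) where
  Adj p q := MutualStrongBJ p.rep q.rep
  symm := ⟨fun _ _ h => h.symm⟩
  loopless := ⟨fun p h => p.rep_nonzero h.eq_zero⟩

theorem orthograph_adj_mk {A : Type*} [CStarAlgebra A] (a b : A) (ha : a ≠ 0) (hb : b ≠ 0) :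
    (orthograph A).Adj (Projectivization.mk ℂ a ha) (Projectivization.mk ℂ b hb) ↔
      MutualStrongBJ a b := by
  obtain ⟨s, hs⟩ := Projectivization.exists_smul_eq_mk_rep ℂ a ha
  obtain ⟨t, ht⟩ := Projectivization.exists_smul_eq_mk_rep ℂ b hb
  have hs' : (s : ℂ) • a = (Projectivization.mk ℂ a ha).rep := hs
  have ht' : (t : ℂ) • b = (Projectivization.mk ℂ b hb).rep := ht
  change MutualStrongBJ (Projectivization.mk ℂ a ha).rep (Projectivization.mk ℂ b hb).rep ↔ _
  rw [← hs', ← ht']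
  constructor
  · intro h
    have h1 := h.1.smul (inv_ne_zero s.ne_zero) ((t : ℂ)⁻¹)
    have h2 := h.2.smul (inv_ne_zero t.ne_zero) ((s : ℂ)⁻¹)
    rw [inv_smul_smul₀ s.ne_zero, inv_smul_smul₀ t.ne_zero] at h1 h2
    exact ⟨h1, h2⟩
  · intro h
    exact ⟨h.1.smul s.ne_zero _, h.2.smul t.ne_zero _⟩

/-- The set of non-isolated vertices of the orthograph. -/
def nonisolatedVertices (A : Type*) [CStarAlgebra A] : Set (ℙ ℂ A) :=
  {p | ∃ q, (orthograph A).Adj p q}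

/-- The diameter of the orthograph of `A`, isolated vertices being disregarded: the supremum in
`ℕ∞` of the graph distances between non-isolated vertices (the distance is `⊤` between vertices that
no path joins). -/
noncomputable def orthographDiam (A : Type*) [CStarAlgebra A] : ℕ∞ :=
  ((orthograph A).induce (nonisolatedVertices A)).ediam

/-! ### Invariance of the orthograph under star isomorphisms -/

/-! Star isomorphisms preserve the orthograph, so the algebra may be taken to be a direct sum of
operator algebras on spaces `E i`. In finite dimension, `a` is strong Birkhoff–James orthogonal to
`b` exactly when some nonzero vector of a single block lies both in the top eigenspace of `a a*` and
in the kernel of `b*` (`mutualStrongBJ_iff`). Adjacency thus becomes a question about vectors.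

A non-isolated vertex has a kernel vector `x` and a top vector `y`, and these are orthogonal. Given
a second vertex with the pair `(z, w)`, the projections onto spans of such vectors yield short
paths: length two if `x ⊥ w` and `z ⊥ y`, length three if there are auxiliary vectors `u ⊥ v` as in
`Separates`. Another block leaves room for `u` and `v`, except when all four vectors lie in the
plane of `ℂ ⊕ M₂`; a path of length four then passes through the one-dimensional block.

The lower bounds come from the operators `lineOp x y`, whose top and kernel are exactly the lines of
`y` and `x`. For these the sufficient conditions above are also necessary, so suitable choices of
lines realize distances three and four. In `ℂ ⊕ ℂ` the only non-isolated vertices are the two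
summands. -/

theorem SimpleGraph.Hom.edist_le {V W : Type*} {G : SimpleGraph V} {H : SimpleGraph W}
    (f : G →g H) (u v : V) : H.edist (f u) (f v) ≤ G.edist u v := by
  by_cases h : G.edist u v = ⊤
  · simp [h]
  · obtain ⟨p, hp⟩ := SimpleGraph.exists_walk_of_edist_ne_top h
    rw [← hp, ← SimpleGraph.Walk.length_map f p]
    exact SimpleGraph.edist_le _

theorem SimpleGraph.Hom.ediam_le_of_surjective {V W : Type*} {G : SimpleGraph V}
    {H : SimpleGraph W} (f : G →g H) (hf : Function.Surjective f) : H.ediam ≤ G.ediam := by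
  refine SimpleGraph.ediam_le_of_edist_le fun u v => ?_
  obtain ⟨u, rfl⟩ := hf u
  obtain ⟨v, rfl⟩ := hf v
  exact (f.edist_le u v).trans SimpleGraph.edist_le_ediam

theorem StrongBJ.map {A B : Type*} [CStarAlgebra A] [CStarAlgebra B] (e : A ≃⋆ₐ[ℂ] B) {a b : A}
    (h : StrongBJ a b) : StrongBJ (e a) (e b) := by
  intro c
  obtain ⟨c, rfl⟩ := EquivLike.surjective e c
  rw [← map_mul, ← map_add, StarAlgEquiv.norm_map, StarAlgEquiv.norm_map]
  exact h c

theorem MutualStrongBJ.map {A B : Type*} [CStarAlgebra A] [CStarAlgebra B] (e : A ≃⋆ₐ[ℂ] B)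
    {a b : A} (h : MutualStrongBJ a b) : MutualStrongBJ (e a) (e b) :=
  ⟨h.1.map e, h.2.map e⟩

theorem orthographDiam_le_of_starAlgEquiv {A B : Type*} [CStarAlgebra A] [CStarAlgebra B]
    (e : A ≃⋆ₐ[ℂ] B) : orthographDiam B ≤ orthographDiam A := by
  let l : A →ₗ[ℂ] B := e.toAlgEquiv.toLinearMap
  have hl : ∀ a, l a = e a := fun _ => rfl
  have hinj : Function.Injective l := e.injective
  have hadj : ∀ {p q : ℙ ℂ A}, (orthograph A).Adj p q →
      (orthograph B).Adj (p.map l hinj) (q.map l hinj) := by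
    intro p q h
    induction p with | h a ha
    induction q with | h b hb
    rw [Projectivization.map_mk, Projectivization.map_mk, orthograph_adj_mk]
    rw [orthograph_adj_mk] at h
    exact h.map e
  -- Adjacency is also reflected, so the preimage of a non-isolated vertex is again non-isolated.
  have hback : ∀ {p q : ℙ ℂ A}, (orthograph B).Adj (p.map l hinj) (q.map l hinj) →
      (orthograph A).Adj p q := by
    intro p q h
    induction p with | h a ha
    induction q with | h b hb
    rw [Projectivization.map_mk, Projectivization.map_mk, orthograph_adj_mk] at h
    rw [orthograph_adj_mk]
    simpa [hl] using h.map e.symm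
  have hsurj : ∀ q : ℙ ℂ B, ∃ p : ℙ ℂ A, p.map l hinj = q := by
    intro q
    induction q with | h b hb
    obtain ⟨a, rfl⟩ := EquivLike.surjective e b
    exact ⟨Projectivization.mk ℂ a fun h => hb (by rw [h, map_zero]), Projectivization.map_mk ..⟩
  let f : (orthograph A).induce (nonisolatedVertices A) →g
      (orthograph B).induce (nonisolatedVertices B) :=
    { toFun := fun p => ⟨p.1.map l hinj, by
        obtain ⟨q, hq⟩ := p.2
        exact ⟨_, hadj hq⟩⟩
      map_rel' := fun h => hadj h }
  refine f.ediam_le_of_surjective ?_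
  rintro ⟨q, r, hr⟩
  obtain ⟨p, rfl⟩ := hsurj q
  obtain ⟨r, rfl⟩ := hsurj r
  exact ⟨⟨p, r, hback hr⟩, rfl⟩

theorem orthographDiam_congr {A B : Type*} [CStarAlgebra A] [CStarAlgebra B]
    (e : A ≃⋆ₐ[ℂ] B) : orthographDiam A = orthographDiam B :=
  le_antisymm (orthographDiam_le_of_starAlgEquiv e.symm) (orthographDiam_le_of_starAlgEquiv e)

/-! ### Block vectors and strong orthogonality in a direct sum of operator algebras -/

section Block

variable {ι : Type*} {E : ι → Type*} [∀ i, NormedAddCommGroup (E i)]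
  [∀ i, InnerProductSpace ℂ (E i)]

/-- Orthogonality of vectors of the Hilbert sum of the `E i` that live in a single summand. -/
def BlockOrth (s t : Σ i, E i) : Prop :=
  ∀ i (u v : E i), s = ⟨i, u⟩ → t = ⟨i, v⟩ → inner ℂ u v = 0

theorem blockOrth_mk {i : ι} {u v : E i} :
    BlockOrth (⟨i, u⟩ : Σ i, E i) ⟨i, v⟩ ↔ inner ℂ u v = 0 := by
  constructor
  · intro h
    exact h i u v rfl rfl
  · rintro h j u' v' ⟨⟩ ⟨⟩
    exact h

theorem BlockOrth.symm {s t : Σ i, E i} (h : BlockOrth s t) : BlockOrth t s :=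
  fun i u v hu hv => inner_eq_zero_symm.1 (h i v u hv hu)

theorem blockOrth_of_ne {s t : Σ i, E i} (h : s.1 ≠ t.1) : BlockOrth s t := by
  rintro i u v rfl rfl
  exact absurd rfl h

theorem BlockOrth.smul_left {i : ι} {u : E i} {t : Σ i, E i} (h : BlockOrth ⟨i, u⟩ t) (c : ℂ) :
    BlockOrth ⟨i, c • u⟩ t := by
  rintro j u' v ⟨⟩ rfl
  rw [blockOrth_mk] at h
  rw [inner_smul_left, h, mul_zero]

theorem not_blockOrth_self {s : Σ i, E i} (h : s.2 ≠ 0) : ¬ BlockOrth s s := by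
  obtain ⟨i, u⟩ := s
  rw [blockOrth_mk, inner_self_eq_zero]
  exact h

variable [Fintype ι] [∀ i, CompleteSpace (E i)]

/-- The block vector `s` is an eigenvector of `a a*` for the eigenvalue `‖a‖²` (or zero). -/
def MemTop (a : ∀ i, E i →L[ℂ] E i) (s : Σ i, E i) : Prop :=
  a s.1 (star (a s.1) s.2) = ((‖a‖ : ℂ) ^ 2) • s.2

/-- The block vector `s` is in the kernel of `a*`, the orthogonal complement of the range. -/
def MemCoker (a : ∀ i, E i →L[ℂ] E i) (s : Σ i, E i) : Prop :=
  star (a s.1) s.2 = 0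

theorem inner_star_apply {F : Type*} [NormedAddCommGroup F] [InnerProductSpace ℂ F]
    [CompleteSpace F] (a : F →L[ℂ] F) (u v : F) :
    inner ℂ (star a u) v = inner ℂ u (a v) := by
  rw [ContinuousLinearMap.star_eq_adjoint, ContinuousLinearMap.adjoint_inner_left]

/-- Since `‖a‖² ≠ 0`, a top vector lies in the range of `a`, which is orthogonal to the kernel of
`a*`. -/
theorem MemTop.blockOrth {a : ∀ i, E i →L[ℂ] E i} (ha : a ≠ 0) {s t : Σ i, E i}
    (hs : MemTop a s) (ht : MemCoker a t) : BlockOrth s t := by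
  rintro i u v rfl rfl
  apply inner_eq_zero_symm.1
  have h1 : inner ℂ v (((‖a‖ : ℂ) ^ 2) • u) = 0 := by
    rw [← show a i (star (a i) u) = _ from hs, ← inner_star_apply,
      show star (a i) v = 0 from ht, inner_zero_left]
  rw [inner_smul_right] at h1
  have h2 : (‖a‖ : ℂ) ^ 2 ≠ 0 := by simpa using ha
  exact (mul_eq_zero.1 h1).resolve_left h2

/-- On the witness, `(a + b c)*` agrees with `a*` because `b*` vanishes there, and `a*` attains its
norm on it. -/
theorem strongBJ_of_memTop {a b : ∀ i, E i →L[ℂ] E i} {s : Σ i, E i} (h0 : s.2 ≠ 0)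
    (hs : MemTop a s) (hb : MemCoker b s) : StrongBJ a b := by
  intro c
  obtain ⟨i, v⟩ := s
  have h0 : 0 < ‖v‖ := norm_pos_iff.2 h0
  have h1 : star ((a + b * c) i) v = star (a i) v := by
    have : star (b i) v = 0 := hb
    simp [this]
  have h2 : ‖star (a i) v‖ = ‖a‖ * ‖v‖ := by
    have h3 : (inner ℂ (star (a i) v) (star (a i) v) : ℂ) = ((‖a‖ * ‖v‖ : ℝ) : ℂ) ^ 2 := by
      rw [inner_star_apply, show a i (star (a i) v) = _ from hs, inner_smul_right,
        inner_self_eq_norm_sq_to_K]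
      push_cast
      simp only [Complex.coe_algebraMap]
      ring
    rw [inner_self_eq_norm_sq_to_K] at h3
    simp only [Complex.coe_algebraMap] at h3
    have h4 : ‖star (a i) v‖ ^ 2 = (‖a‖ * ‖v‖) ^ 2 := by exact_mod_cast h3
    exact (pow_left_inj₀ (norm_nonneg _) (by positivity) two_ne_zero).1 h4
  have h3 : ‖a‖ * ‖v‖ ≤ ‖a + b * c‖ * ‖v‖ := by
    rw [← h2, ← h1]
    refine (ContinuousLinearMap.le_opNorm _ _).trans ?_
    gcongr
    rw [norm_star]
    exact norm_le_pi_norm (a + b * c) i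
  exact le_of_mul_le_mul_right h3 h0

/-- A linear right inverse of `b` onto its range gives `c`. Then `a - b c` is the part of `a`
orthogonal to the range of `b`, the decisive test for strong orthogonality. -/
theorem exists_mul_eq_starProjection_mul {F : Type*} [NormedAddCommGroup F]
    [InnerProductSpace ℂ F] [FiniteDimensional ℂ F] (a b : F →L[ℂ] F) :
    ∃ c : F →L[ℂ] F, b * c = (LinearMap.range b.toLinearMap).starProjection * a := by
  obtain ⟨g, hg⟩ := (b.toLinearMap.rangeRestrict).exists_rightInverse_of_surjective
    (LinearMap.range_rangeRestrict _)
  refine ⟨LinearMap.toContinuousLinearMap (g ∘ₗ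
    (LinearMap.range b.toLinearMap).orthogonalProjectionOnto.toLinearMap) * a, ?_⟩
  ext v
  have := congrArg Subtype.val (LinearMap.congr_fun hg
    ((LinearMap.range b.toLinearMap).orthogonalProjectionOnto (a v)))
  simpa using this

/-- The closed unit ball is compact. Asking for `‖v‖ ≤ 1` instead of equality admits the zero space.
-/
theorem exists_norm_eq_opNorm {F : Type*} [NormedAddCommGroup F]
    [InnerProductSpace ℂ F] [FiniteDimensional ℂ F] (a : F →L[ℂ] F) :
    ∃ v : F, ‖v‖ ≤ 1 ∧ ‖a v‖ = ‖a‖ := by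
  have : ProperSpace F := FiniteDimensional.proper ℂ F
  obtain ⟨v, hv, hmax⟩ := (isCompact_closedBall (0 : F) 1).exists_isMaxOn
    ⟨0, by simp⟩ (a.continuous.norm.continuousOn)
  have hv1 : ‖v‖ ≤ 1 := by simpa using hv
  refine ⟨v, hv1, le_antisymm ((a.le_opNorm v).trans
    (mul_le_of_le_one_right (norm_nonneg _) hv1)) ?_⟩
  refine ContinuousLinearMap.opNorm_le_of_unit_norm (norm_nonneg _) fun x hx => ?_
  exact hmax (by simp [hx])

/-- With `p` the projection onto the range of `b`, some block of `(1 - p) a` still has norm at least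
`‖a‖`. Its adjoint attains its norm at some `v`, and `w = (1 - p) v` is the witness: all the
estimates for `w` must be equalities. -/
theorem StrongBJ.exists_memTop [∀ i, FiniteDimensional ℂ (E i)] {a b : ∀ i, E i →L[ℂ] E i}
    (ha : a ≠ 0) (h : StrongBJ a b) : ∃ s : Σ i, E i, s.2 ≠ 0 ∧ MemTop a s ∧ MemCoker b s := by
  choose c hc using fun i => exists_mul_eq_starProjection_mul (a i) (b i)
  have h1 := h (-c)
  have hpos : 0 < ‖a‖ := norm_pos_iff.2 ha
  obtain ⟨i, hi⟩ : ∃ i, ‖a‖ ≤ ‖(a + b * -c) i‖ := by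
    by_contra! hlt
    exact absurd h1 (not_le.2 ((pi_norm_lt_iff hpos).2 hlt))
  set p := (LinearMap.range (b i).toLinearMap).starProjection with hp
  obtain ⟨v, hv, hnorm⟩ := exists_norm_eq_opNorm (star ((a + b * -c) i))
  have hsp : star p = p := isSelfAdjoint_starProjection _
  have h2 : star ((a + b * -c) i) v = star (a i) (v - p v) := by
    have : (a + b * -c) i = a i - p * a i := by
      rw [Pi.add_apply, Pi.mul_apply, Pi.neg_apply, mul_neg, hc i, sub_eq_add_neg]
    rw [this, star_sub, star_mul, hsp]
    simp
  rw [norm_star, h2] at hnorm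
  set w := v - p v with hw
  have hle : ‖star (a i) w‖ ≤ ‖a‖ * ‖w‖ := by
    refine (ContinuousLinearMap.le_opNorm _ _).trans ?_
    gcongr
    rw [norm_star]
    exact norm_le_pi_norm a i
  have hge : ‖a‖ ≤ ‖star (a i) w‖ := hnorm ▸ hi
  have hw1 : ‖w‖ ≤ 1 := by
    have : w = (LinearMap.range (b i).toLinearMap)ᗮ.starProjection v := by
      rw [Submodule.starProjection_orthogonal_val]
    rw [this]
    exact (Submodule.norm_starProjection_apply_le _ _).trans hv
  have hw2 : ‖w‖ = 1 := by
    refine le_antisymm hw1 ?_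
    exact le_of_mul_le_mul_left (by linarith) hpos
  refine ⟨⟨i, w⟩, fun h => by simp [show w = 0 from h] at hw2, ?_, ?_⟩
  · change a i (star (a i) w) = _ • w
    -- Expanding the square of the norm of `a a* w - ‖a‖² w` bounds it by `‖a‖⁴ - 2‖a‖⁴ + ‖a‖⁴ = 0`.
    rw [← sub_eq_zero, ← norm_eq_zero, ← sq_eq_zero_iff]
    have h3 : ‖star (a i) w‖ = ‖a‖ := le_antisymm (by simpa [hw2] using hle) hge
    have h4 : ‖a i (star (a i) w)‖ ≤ ‖a‖ * ‖a‖ := by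
      refine (ContinuousLinearMap.le_opNorm _ _).trans ?_
      rw [h3]
      gcongr
      exact norm_le_pi_norm a i
    have h5 : RCLike.re (inner ℂ (a i (star (a i) w)) (((‖a‖ : ℂ) ^ 2) • w)) = ‖a‖ ^ 4 := by
      rw [inner_smul_right, ← inner_conj_symm, ← inner_star_apply, inner_self_eq_norm_sq_to_K, h3]
      simp only [Complex.coe_algebraMap, map_pow, Complex.conj_ofReal]
      rw [← pow_add]
      norm_cast
    refine le_antisymm ?_ (sq_nonneg _)
    rw [@norm_sub_sq ℂ, h5, norm_smul, hw2]
    simp only [norm_pow, Complex.norm_real, norm_norm]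
    have := mul_self_le_mul_self (norm_nonneg _) h4
    nlinarith
  · change star (b i) w = 0
    refine ext_inner_right ℂ fun x => ?_
    rw [inner_star_apply, inner_zero_left]
    exact Submodule.starProjection_inner_eq_zero v _ (LinearMap.mem_range_self _ x)

/-- In a direct sum of operator algebras, mutual strong orthogonality is witnessed by two block
vectors. -/
theorem mutualStrongBJ_iff [∀ i, FiniteDimensional ℂ (E i)] {a b : ∀ i, E i →L[ℂ] E i}
    (ha : a ≠ 0) (hb : b ≠ 0) :
    MutualStrongBJ a b ↔ (∃ s : Σ i, E i, s.2 ≠ 0 ∧ MemTop a s ∧ MemCoker b s) ∧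
      ∃ s : Σ i, E i, s.2 ≠ 0 ∧ MemTop b s ∧ MemCoker a s :=
  ⟨fun h => ⟨h.1.exists_memTop ha, h.2.exists_memTop hb⟩,
    fun ⟨⟨_, h1, h2, h3⟩, ⟨_, h4, h5, h6⟩⟩ =>
      ⟨strongBJ_of_memTop h1 h2 h3, strongBJ_of_memTop h4 h5 h6⟩⟩

end Block

/-! ### Two families of test elements -/

section TestElements

variable {ι : Type*} {E : ι → Type*} [∀ i, NormedAddCommGroup (E i)]
  [∀ i, InnerProductSpace ℂ (E i)]

/-- The span, in the `i`-th summand, of a set of block vectors. -/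
def blockSpan (T : Set (Σ i, E i)) (i : ι) : Submodule ℂ (E i) :=
  Submodule.span ℂ {u | (⟨i, u⟩ : Σ i, E i) ∈ T}

theorem mem_blockSpan {T : Set (Σ i, E i)} {s : Σ i, E i} (h : s ∈ T) :
    s.2 ∈ blockSpan T s.1 :=
  Submodule.subset_span h

theorem mem_blockSpan_orthogonal {T : Set (Σ i, E i)} {s : Σ i, E i}
    (h : ∀ t ∈ T, BlockOrth t s) : s.2 ∈ (blockSpan T s.1)ᗮ := by
  obtain ⟨i, v⟩ := s
  rw [blockSpan, Submodule.mem_orthogonal]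
  intro u hu
  induction hu using Submodule.span_induction with
  | mem u hu => exact blockOrth_mk.1 (h _ hu)
  | zero => simp
  | add u w _ _ hu hw => rw [inner_add_left, hu, hw, add_zero]
  | smul c u _ hu => rw [inner_smul_left, hu, mul_zero]

theorem exists_eq_smul_of_mem_blockSpan {y s : Σ i, E i} (h : s.2 ∈ blockSpan {y} s.1)
    (h0 : s.2 ≠ 0) : ∃ c : ℂ, c ≠ 0 ∧ s = ⟨y.1, c • y.2⟩ := by
  obtain ⟨i, v⟩ := s
  obtain ⟨j, u⟩ := y
  by_cases hij : i = j
  · subst hij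
    have : {w : E i | (⟨i, w⟩ : Σ i, E i) ∈ ({⟨i, u⟩} : Set (Σ i, E i))} = {u} := by
      ext w
      simp
    rw [blockSpan, this, Submodule.mem_span_singleton] at h
    obtain ⟨c, hc⟩ := h
    refine ⟨c, ?_, by rw [hc]⟩
    rintro rfl
    exact h0 (by rw [← hc, zero_smul])
  · have : {w : E i | (⟨i, w⟩ : Σ i, E i) ∈ ({⟨j, u⟩} : Set (Σ i, E i))} = ∅ := by
      ext w
      simp [hij]
    rw [blockSpan, this, Submodule.span_empty, Submodule.mem_bot] at h
    exact absurd h h0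

/-- Two block vectors with the same orthogonality relations. -/
theorem blockOrth_iff_of_mem_blockSpan {y s t : Σ i, E i} (h : s.2 ∈ blockSpan {y} s.1)
    (h0 : s.2 ≠ 0) : BlockOrth s t ↔ BlockOrth y t := by
  obtain ⟨c, hc, rfl⟩ := exists_eq_smul_of_mem_blockSpan h h0
  refine ⟨fun h => ?_, fun h => h.smul_left c⟩
  simpa [smul_smul, inv_mul_cancel₀ hc] using h.smul_left c⁻¹

theorem norm_eq_one_of_apply_eq [Fintype ι] {a : ∀ i, E i →L[ℂ] E i} (h : ∀ i v, ‖a i v‖ ≤ ‖v‖)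
    {s : Σ i, E i} (h0 : s.2 ≠ 0) (hs : a s.1 s.2 = s.2) : ‖a‖ = 1 := by
  refine le_antisymm ?_ ?_
  · refine (pi_norm_le_iff_of_nonneg zero_le_one).2 fun i => ?_
    exact ContinuousLinearMap.opNorm_le_bound _ zero_le_one fun v => by simpa using h i v
  · refine le_trans ?_ (norm_le_pi_norm a s.1)
    have := (a s.1).le_opNorm s.2
    rw [hs] at this
    exact le_of_mul_le_mul_right (by simpa using this) (norm_pos_iff.2 h0)

variable [∀ i, FiniteDimensional ℂ (E i)]

/-- The projection onto the span of a set of block vectors. -/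
noncomputable def blockProj (T : Set (Σ i, E i)) (i : ι) : E i →L[ℂ] E i :=
  (blockSpan T i).starProjection

theorem blockProj_apply_of_mem {T : Set (Σ i, E i)} {s : Σ i, E i} (h : s ∈ T) :
    blockProj T s.1 s.2 = s.2 :=
  Submodule.starProjection_eq_self_iff.2 (mem_blockSpan h)

theorem blockProj_apply_of_orth {T : Set (Σ i, E i)} {s : Σ i, E i}
    (h : ∀ t ∈ T, BlockOrth t s) : blockProj T s.1 s.2 = 0 :=
  (Submodule.starProjection_apply_eq_zero_iff _).2 (mem_blockSpan_orthogonal h)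

/-- A positive contraction with the eigenvalue `1` on the line of `y`, with the eigenvalue `0` on
the line of `x`, and with the eigenvalue `1/2` elsewhere. -/
noncomputable def lineOp (x y : Σ i, E i) (i : ι) : E i →L[ℂ] E i :=
  (2⁻¹ : ℂ) • (1 + blockProj {y} i - blockProj {x} i)

theorem blockProj_blockProj_of_orth {x y : Σ i, E i} (h : BlockOrth x y) (i : ι) (v : E i) :
    blockProj {x} i (blockProj {y} i v) = 0 := by
  rw [blockProj, Submodule.starProjection_apply_eq_zero_iff]
  by_cases h0 : blockProj {y} i v = 0
  · rw [h0]
    exact Submodule.zero_mem _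
  · refine mem_blockSpan_orthogonal (s := ⟨i, blockProj {y} i v⟩) ?_
    rintro t rfl
    exact ((blockOrth_iff_of_mem_blockSpan (Submodule.starProjection_apply_mem _ v) h0).2
      h.symm).symm

theorem blockProj_blockProj (T : Set (Σ i, E i)) (i : ι) (v : E i) :
    blockProj T i (blockProj T i v) = blockProj T i v :=
  Submodule.starProjection_eq_self_iff.2 (Submodule.starProjection_apply_mem _ v)

theorem lineOp_apply (x y : Σ i, E i) (i : ι) (v : E i) :
    lineOp x y i v = (2⁻¹ : ℂ) • (v + blockProj {y} i v - blockProj {x} i v) := by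
  simp [lineOp]

theorem norm_lineOp_apply_le (x y : Σ i, E i) (i : ι) (v : E i) :
    ‖lineOp x y i v‖ ≤ ‖v‖ := by
  have h1 : ‖blockProj {y} i v‖ ≤ ‖v‖ := Submodule.norm_starProjection_apply_le _ v
  have h2 : ‖v - blockProj {x} i v‖ ≤ ‖v‖ := by
    rw [blockProj, ← Submodule.starProjection_orthogonal_val]
    exact Submodule.norm_starProjection_apply_le _ v
  rw [lineOp_apply, add_sub_right_comm, norm_smul]
  have := norm_add_le (v - blockProj {x} i v) (blockProj {y} i v)
  norm_num
  linarith

theorem lineOp_apply_top {x y : Σ i, E i} (hxy : BlockOrth x y) : lineOp x y y.1 y.2 = y.2 := by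
  rw [lineOp_apply, blockProj_apply_of_mem (Set.mem_singleton y), blockProj_apply_of_orth (T := {x})
    (by rintro t rfl; exact hxy), sub_zero, ← two_smul ℂ, smul_smul]
  simp

theorem lineOp_apply_bot {x y : Σ i, E i} (hxy : BlockOrth x y) : lineOp x y x.1 x.2 = 0 := by
  rw [lineOp_apply, blockProj_apply_of_mem (Set.mem_singleton x), blockProj_apply_of_orth
    (by rintro t rfl; exact hxy.symm)]
  simp

theorem norm_blockProj [Fintype ι] {T : Set (Σ i, E i)} {s : Σ i, E i} (h0 : s.2 ≠ 0)
    (hs : s ∈ T) :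
    ‖(blockProj T : ∀ i, E i →L[ℂ] E i)‖ = 1 :=
  norm_eq_one_of_apply_eq (fun _ v => Submodule.norm_starProjection_apply_le _ v) h0
    (blockProj_apply_of_mem hs)

theorem norm_lineOp [Fintype ι] {x y : Σ i, E i} (hxy : BlockOrth x y) (hy : y.2 ≠ 0) :
    ‖(lineOp x y : ∀ i, E i →L[ℂ] E i)‖ = 1 :=
  norm_eq_one_of_apply_eq (norm_lineOp_apply_le x y) hy (lineOp_apply_top hxy)

variable [∀ i, CompleteSpace (E i)]

theorem star_blockProj (T : Set (Σ i, E i)) (i : ι) :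
    star (blockProj T i) = blockProj T i :=
  isSelfAdjoint_starProjection _

theorem star_lineOp (x y : Σ i, E i) (i : ι) : star (lineOp x y i) = lineOp x y i := by
  simp [lineOp, star_blockProj]

theorem memCoker_blockProj {T : Set (Σ i, E i)} {s : Σ i, E i} (h : ∀ t ∈ T, BlockOrth t s) :
    MemCoker (blockProj T) s := by
  rw [MemCoker, star_blockProj, blockProj_apply_of_orth h]

theorem memCoker_lineOp {x y : Σ i, E i} (hxy : BlockOrth x y) : MemCoker (lineOp x y) x := by
  rw [MemCoker, star_lineOp, lineOp_apply_bot hxy]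

/-- With `P`, `Q` the projections onto the lines of `x`, `y`, the equation is `s + Q s - P s = 0`.
Applying `Q` gives `2 Q s = 0`, hence `s = P s`. -/
theorem MemCoker.mem_blockSpan_of_lineOp {x y : Σ i, E i} (hxy : BlockOrth x y)
    {s : Σ i, E i} (h : MemCoker (lineOp x y) s) :
    s.2 ∈ blockSpan {x} s.1 := by
  rw [MemCoker, star_lineOp, lineOp_apply] at h
  have h1 := (smul_eq_zero.1 h).resolve_left (by norm_num)
  have h2 := congrArg (blockProj {y} s.1) h1
  rw [map_sub, map_add, blockProj_blockProj, blockProj_blockProj_of_orth hxy.symm, sub_zero,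
    map_zero, ← two_smul ℂ] at h2
  rw [(smul_eq_zero.1 h2).resolve_left two_ne_zero, add_zero, sub_eq_zero] at h1
  rw [h1]
  exact Submodule.starProjection_apply_mem _ _

variable [Fintype ι]

theorem blockProj_ne_zero {T : Set (Σ i, E i)} {s : Σ i, E i} (h0 : s.2 ≠ 0) (hs : s ∈ T) :
    (blockProj T : ∀ i, E i →L[ℂ] E i) ≠ 0 := by
  intro h
  have := norm_blockProj h0 hs
  rw [h, norm_zero] at this
  exact zero_ne_one this

theorem memTop_blockProj {T : Set (Σ i, E i)} {s : Σ i, E i} (h0 : s.2 ≠ 0) (hs : s ∈ T) :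
    MemTop (blockProj T) s := by
  rw [MemTop, norm_blockProj h0 hs, star_blockProj, blockProj_apply_of_mem hs,
    blockProj_apply_of_mem hs]
  simp

theorem lineOp_ne_zero {x y : Σ i, E i} (hxy : BlockOrth x y) (hy : y.2 ≠ 0) :
    (lineOp x y : ∀ i, E i →L[ℂ] E i) ≠ 0 := by
  intro h
  have := norm_lineOp hxy hy
  rw [h, norm_zero] at this
  exact zero_ne_one this

theorem memTop_lineOp {x y : Σ i, E i} (hxy : BlockOrth x y) (hy : y.2 ≠ 0) :
    MemTop (lineOp x y) y := by
  rw [MemTop, norm_lineOp hxy hy, star_lineOp, lineOp_apply_top hxy, lineOp_apply_top hxy]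
  simp

/-- With the same `P` and `Q`, the square of `lineOp x y` is `(1 + 3 Q - P) / 4`, so `3 s = 3 Q s -
P s`. Applying `P` gives `4 P s = 0`, hence `s = Q s`. -/
theorem MemTop.mem_blockSpan_of_lineOp {x y : Σ i, E i} (hxy : BlockOrth x y)
    (hy : y.2 ≠ 0) {s : Σ i, E i} (h : MemTop (lineOp x y) s) :
    s.2 ∈ blockSpan {y} s.1 := by
  rw [MemTop, norm_lineOp hxy hy, star_lineOp] at h
  simp only [Complex.ofReal_one, one_pow, one_smul] at h
  rw [lineOp_apply x y s.1 s.2, map_smul, lineOp_apply, smul_smul] at h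
  simp only [map_sub, map_add, blockProj_blockProj, blockProj_blockProj_of_orth hxy,
    blockProj_blockProj_of_orth hxy.symm] at h
  have h1 : (3 : ℂ) • s.2 = (3 : ℂ) • blockProj {y} s.1 s.2 - blockProj {x} s.1 s.2 := by
    have h2 := congrArg (fun v => (4 : ℂ) • v) h
    simp only [smul_smul] at h2
    norm_num at h2
    rw [show (3 : ℂ) • s.2 = (4 : ℂ) • s.2 - s.2 by module, ← h2]
    module
  have h2 := congrArg (blockProj {x} s.1) h1
  rw [map_sub, map_smul, map_smul, blockProj_blockProj, blockProj_blockProj_of_orth hxy,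
    smul_zero, zero_sub] at h2
  have h3 : (4 : ℂ) • blockProj {x} s.1 s.2 = 0 := by
    rw [show (4 : ℂ) • blockProj {x} s.1 s.2 = (3 : ℂ) • blockProj {x} s.1 s.2
      + blockProj {x} s.1 s.2 by module, h2]
    simp
  rw [(smul_eq_zero.1 h3).resolve_left (by norm_num), sub_zero] at h1
  rw [(smul_right_injective _ (by norm_num : (3 : ℂ) ≠ 0)) h1]
  exact Submodule.starProjection_apply_mem _ _

end TestElements

/-! ### Existence of orthogonal block vectors -/

section Orthogonal

theorem exists_ne_zero_orthogonal {F : Type*} [NormedAddCommGroup F] [InnerProductSpace ℂ F]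
    [FiniteDimensional ℂ F] (T : Finset F) (h : T.card < Module.finrank ℂ F) :
    ∃ u : F, u ≠ 0 ∧ ∀ t ∈ T, inner ℂ u t = 0 := by
  have h1 : (Submodule.span ℂ (T : Set F))ᗮ ≠ ⊥ := by
    intro h2
    have h3 := Submodule.finrank_add_finrank_orthogonal (Submodule.span ℂ (T : Set F))
    rw [h2, finrank_bot] at h3
    have h4 : Module.finrank ℂ (Submodule.span ℂ (T : Set F)) ≤ T.card :=
      finrank_span_finset_le_card T
    omega
  obtain ⟨u, hu, h0⟩ := Submodule.exists_mem_ne_zero_of_ne_bot h1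
  exact ⟨u, h0, fun t ht => inner_eq_zero_symm.1
    ((Submodule.mem_orthogonal _ _).1 hu t (Submodule.subset_span ht))⟩

theorem two_le_finrank_of_inner_eq_zero {F : Type*} [NormedAddCommGroup F]
    [InnerProductSpace ℂ F] [FiniteDimensional ℂ F] {u v : F} (hu : u ≠ 0) (hv : v ≠ 0)
    (h : inner ℂ u v = 0) : 2 ≤ Module.finrank ℂ F := by
  by_contra! hlt
  obtain ⟨r, hr⟩ := finrank_le_one_iff.1 (Nat.lt_succ_iff.1 hlt)
  obtain ⟨c, rfl⟩ := hr u
  obtain ⟨d, rfl⟩ := hr v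
  simp only [ne_eq, smul_eq_zero, not_or] at hu hv
  simp [hu.1, hu.2, hv.1] at h

variable {ι : Type*} {E : ι → Type*} [∀ i, NormedAddCommGroup (E i)]
  [∀ i, InnerProductSpace ℂ (E i)] [∀ i, FiniteDimensional ℂ (E i)]

/-- The vectors `u` and `v` separate the orthogonal pairs `(x, y)` and `(z, w)`. -/
def Separates (x y z w u v : Σ i, E i) : Prop :=
  u.2 ≠ 0 ∧ v.2 ≠ 0 ∧ BlockOrth u y ∧ BlockOrth u z ∧ BlockOrth v x ∧ BlockOrth v w ∧
    BlockOrth u v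

/-- Since `x` and `w` share the block `i`, any `v` in another block is orthogonal to both; it
remains to find `u` orthogonal to `y` and `z` outside the block of `v`. With three blocks, some
block free of `y` and `z` supplies `u`. With two, dimension counts in block `i` suffice unless all
four vectors lie there; even then a third dimension in block `i`, or a second one in block `j`, is
enough. -/
theorem exists_separates_of_not_blockOrth [Nontrivial ι] [∀ i, Nontrivial (E i)]
    {x y z w : Σ i, E i} (hx : x.2 ≠ 0) (hy : y.2 ≠ 0) (hz : z.2 ≠ 0) (hw : w.2 ≠ 0)
    (hxy : BlockOrth x y) (hzw : BlockOrth z w) (hxw : ¬ BlockOrth x w) :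
    (∃ u v, Separates x y z w u v) ∨
      ∃ i j : ι, i ≠ j ∧ (∀ l, l = i ∨ l = j) ∧ Module.finrank ℂ (E i) = 2 ∧
        Module.finrank ℂ (E j) = 1 ∧ x.1 = i ∧ y.1 = i ∧ z.1 = i ∧ w.1 = i := by
  classical
  obtain ⟨i, x⟩ := x
  obtain ⟨i', w⟩ := w
  obtain rfl : i = i' := by
    by_contra h
    exact hxw (blockOrth_of_ne h)
  choose e he using fun j => exists_ne (0 : E j)
  have key : ∀ l (u : E l) j, j ≠ i → j ≠ l → u ≠ 0 → BlockOrth ⟨l, u⟩ y → BlockOrth ⟨l, u⟩ z →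
      ∃ u v, Separates ⟨i, x⟩ y z ⟨i, w⟩ u v := fun l u j hji hjl hu h1 h2 =>
    ⟨⟨l, u⟩, ⟨j, e j⟩, hu, he j, h1, h2, blockOrth_of_ne hji, blockOrth_of_ne hji,
      blockOrth_of_ne hjl.symm⟩
  have hfree : ∀ l j, j ≠ i → j ≠ l → y.1 ≠ l → z.1 ≠ l →
      ∃ u v, Separates ⟨i, x⟩ y z ⟨i, w⟩ u v := fun l j hji hjl h1 h2 =>
    key l (e l) j hji hjl (he l) (blockOrth_of_ne h1.symm) (blockOrth_of_ne h2.symm)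
  obtain ⟨j, hj⟩ := exists_ne i
  by_cases h3 : ∃ j', j' ≠ i ∧ j' ≠ j
  · obtain ⟨j', hj', hjj'⟩ := h3
    left
    by_cases h4 : y.1 ≠ j ∧ z.1 ≠ j
    · exact hfree j j' hj' hjj' h4.1 h4.2
    by_cases h5 : y.1 ≠ j' ∧ z.1 ≠ j'
    · exact hfree j' j hj hjj'.symm h5.1 h5.2
    exact hfree i j hj hj (by grind) (by grind)
  · push Not at h3
    obtain ⟨k, y⟩ := y
    obtain ⟨m, z⟩ := z
    by_cases hk : k = i <;> by_cases hm : m = i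
    · subst hk hm
      rw [blockOrth_mk] at hxy hzw
      have hi2 : 2 ≤ Module.finrank ℂ (E m) := two_le_finrank_of_inner_eq_zero hx hy hxy
      by_cases hj2 : 2 ≤ Module.finrank ℂ (E j)
      · left
        obtain ⟨v, hv, hv1⟩ := exists_ne_zero_orthogonal {e j}
          (by rwa [Finset.card_singleton])
        exact ⟨⟨j, e j⟩, ⟨j, v⟩, he j, hv, blockOrth_of_ne hj, blockOrth_of_ne hj,
          blockOrth_of_ne hj, blockOrth_of_ne hj,
          (blockOrth_mk.2 (hv1 _ (Finset.mem_singleton_self _))).symm⟩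
      by_cases hi3 : 3 ≤ Module.finrank ℂ (E m)
      · left
        obtain ⟨u, hu, hu1⟩ := exists_ne_zero_orthogonal {y, z}
          (lt_of_le_of_lt Finset.card_le_two hi3)
        exact key m u j hj hj hu (blockOrth_mk.2 (hu1 _ (by simp)))
          (blockOrth_mk.2 (hu1 _ (by simp)))
      · right
        have hj1 : 0 < Module.finrank ℂ (E j) := Module.finrank_pos
        refine ⟨m, j, hj.symm, fun l => ?_, by omega, by omega, rfl, rfl, rfl, rfl⟩
        by_cases hl : l = m
        · exact Or.inl hl
        · exact Or.inr (h3 l hl)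
    · subst hk
      left
      obtain ⟨u, hu, hu1⟩ := exists_ne_zero_orthogonal {y}
        (by rw [Finset.card_singleton]
            exact two_le_finrank_of_inner_eq_zero hx hy (blockOrth_mk.1 hxy))
      exact key k u j hj hj hu (blockOrth_mk.2 (hu1 _ (by simp))) (blockOrth_of_ne (Ne.symm hm))
    · subst hm
      left
      obtain ⟨u, hu, hu1⟩ := exists_ne_zero_orthogonal {z}
        (by rw [Finset.card_singleton]
            exact two_le_finrank_of_inner_eq_zero hz hw (blockOrth_mk.1 hzw))
      exact key m u j hj hj hu (blockOrth_of_ne (Ne.symm hk)) (blockOrth_mk.2 (hu1 _ (by simp)))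
    · exact Or.inl (hfree i j hj hj hk hm)

theorem blockOrth_or_exists_separates [Nontrivial ι] [∀ i, Nontrivial (E i)]
    {x y z w : Σ i, E i} (hx : x.2 ≠ 0) (hy : y.2 ≠ 0) (hz : z.2 ≠ 0) (hw : w.2 ≠ 0)
    (hxy : BlockOrth x y) (hzw : BlockOrth z w) :
    (BlockOrth x w ∧ BlockOrth z y) ∨ (∃ u v, Separates x y z w u v) ∨
      ∃ i j : ι, i ≠ j ∧ (∀ l, l = i ∨ l = j) ∧ Module.finrank ℂ (E i) = 2 ∧
        Module.finrank ℂ (E j) = 1 ∧ x.1 = i ∧ y.1 = i ∧ z.1 = i ∧ w.1 = i := by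
  by_cases hxw : BlockOrth x w
  · by_cases hzy : BlockOrth z y
    · exact Or.inl ⟨hxw, hzy⟩
    right
    -- Exchanging the two pairs exchanges the roles of `u` and `v`.
    rcases exists_separates_of_not_blockOrth hz hw hx hy hzw hxy hzy with
      ⟨u, v, h1, h2, h3, h4, h5, h6, h7⟩ | ⟨i, j, h1, h2, h3, h4, h5, h6, h7, h8⟩
    · exact Or.inl ⟨v, u, h2, h1, h6, h5, h4, h3, h7.symm⟩
    · exact Or.inr ⟨i, j, h1, h2, h3, h4, h7, h8, h5, h6⟩
  · exact Or.inr (exists_separates_of_not_blockOrth hx hy hz hw hxy hzw hxw)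

end Orthogonal

/-! ### Distances in the orthograph -/

theorem SimpleGraph.exists_of_edist_lt_four {V : Type*} {G : SimpleGraph V} {u v : V}
    (h : G.edist u v < 4) :
    u = v ∨ G.Adj u v ∨ (∃ r, G.Adj u r ∧ G.Adj r v) ∨
      ∃ r s, G.Adj u r ∧ G.Adj r s ∧ G.Adj s v := by
  obtain ⟨p, hp⟩ := SimpleGraph.exists_walk_of_edist_ne_top (ne_top_of_lt h)
  rw [← hp] at h
  have h4 : p.length < 4 := by exact_mod_cast h
  match p, h4 with
  | .nil, _ => exact Or.inl rfl
  | .cons h1 .nil, _ => exact Or.inr (Or.inl h1)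
  | .cons h1 (.cons h2 .nil), _ => exact Or.inr (Or.inr (Or.inl ⟨_, h1, h2⟩))
  | .cons h1 (.cons h2 (.cons h3 .nil)), _ =>
    exact Or.inr (Or.inr (Or.inr ⟨_, _, h1, h2, h3⟩))
  | .cons h1 (.cons h2 (.cons h3 (.cons h4 q))), hlt =>
    simp only [SimpleGraph.Walk.length_cons] at hlt
    omega

/-- The orthograph without its isolated vertices. -/
def coreGraph (A : Type*) [CStarAlgebra A] : SimpleGraph (nonisolatedVertices A) :=
  (orthograph A).induce (nonisolatedVertices A)

section Walks

variable {A : Type*} [CStarAlgebra A] {p q : nonisolatedVertices A}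

theorem edist_coreGraph_le_two {r : ℙ ℂ A} (h1 : (orthograph A).Adj p r)
    (h2 : (orthograph A).Adj r q) : (coreGraph A).edist p q ≤ 2 := by
  have h1' : (coreGraph A).Adj p ⟨r, q, h2⟩ := h1
  have h2' : (coreGraph A).Adj ⟨r, q, h2⟩ q := h2
  exact (SimpleGraph.Walk.cons h1' (.cons h2' .nil)).edist_le

theorem edist_coreGraph_le_three {r s : ℙ ℂ A} (h1 : (orthograph A).Adj p r)
    (h2 : (orthograph A).Adj r s) (h3 : (orthograph A).Adj s q) :
    (coreGraph A).edist p q ≤ 3 := by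
  have h1' : (coreGraph A).Adj p ⟨r, s, h2⟩ := h1
  have h2' : (coreGraph A).Adj ⟨r, s, h2⟩ ⟨s, q, h3⟩ := h2
  have h3' : (coreGraph A).Adj ⟨s, q, h3⟩ q := h3
  exact (SimpleGraph.Walk.cons h1' (.cons h2' (.cons h3' .nil))).edist_le

theorem edist_coreGraph_le_four {r s t : ℙ ℂ A} (h1 : (orthograph A).Adj p r)
    (h2 : (orthograph A).Adj r s) (h3 : (orthograph A).Adj s t) (h4 : (orthograph A).Adj t q) :
    (coreGraph A).edist p q ≤ 4 := by
  have h1' : (coreGraph A).Adj p ⟨r, s, h2⟩ := h1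
  have h2' : (coreGraph A).Adj ⟨r, s, h2⟩ ⟨s, t, h3⟩ := h2
  have h3' : (coreGraph A).Adj ⟨s, t, h3⟩ ⟨t, q, h4⟩ := h3
  have h4' : (coreGraph A).Adj ⟨t, q, h4⟩ q := h4
  exact (SimpleGraph.Walk.cons h1' (.cons h2' (.cons h3' (.cons h4' .nil)))).edist_le

end Walks

section BlockGraph

variable {ι : Type*} [Fintype ι] {E : ι → Type*} [∀ i, NormedAddCommGroup (E i)]
  [∀ i, InnerProductSpace ℂ (E i)] [∀ i, FiniteDimensional ℂ (E i)] [∀ i, CompleteSpace (E i)]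

/-- The direct sum of the algebras of operators of a family of Hilbert spaces. -/
abbrev BlockOps (E : ι → Type*) [∀ i, NormedAddCommGroup (E i)]
    [∀ i, InnerProductSpace ℂ (E i)] : Type _ :=
  ∀ i, E i →L[ℂ] E i

theorem orthograph_adj_iff {p q : ℙ ℂ (BlockOps E)} :
    (orthograph (BlockOps E)).Adj p q ↔
      (∃ s : Σ i, E i, s.2 ≠ 0 ∧ MemTop p.rep s ∧ MemCoker q.rep s) ∧
        ∃ s : Σ i, E i, s.2 ≠ 0 ∧ MemTop q.rep s ∧ MemCoker p.rep s :=
  mutualStrongBJ_iff p.rep_nonzero q.rep_nonzero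

theorem orthograph_adj_mk_right {p : ℙ ℂ (BlockOps E)} {b : BlockOps E} (hb : b ≠ 0) :
    (orthograph (BlockOps E)).Adj p (Projectivization.mk ℂ b hb) ↔
      (∃ s : Σ i, E i, s.2 ≠ 0 ∧ MemTop p.rep s ∧ MemCoker b s) ∧
        ∃ s : Σ i, E i, s.2 ≠ 0 ∧ MemTop b s ∧ MemCoker p.rep s := by
  nth_rw 1 [← p.mk_rep]
  rw [orthograph_adj_mk, mutualStrongBJ_iff p.rep_nonzero hb]

theorem exists_memTop_memCoker_of_mem (p : nonisolatedVertices (BlockOps E)) :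
    ∃ x y : Σ i, E i, x.2 ≠ 0 ∧ y.2 ≠ 0 ∧ MemCoker p.1.rep x ∧ MemTop p.1.rep y ∧
      BlockOrth x y := by
  obtain ⟨p, q, h⟩ := p
  obtain ⟨⟨y, hy, hy1, -⟩, ⟨x, hx, -, hx1⟩⟩ := orthograph_adj_iff.1 h
  exact ⟨x, y, hx, hy, hx1, hy1, (hy1.blockOrth p.rep_nonzero hx1).symm⟩

/-- The vertex of the projection onto the span of a set of block vectors. -/
noncomputable def projVertex (T : Set (Σ i, E i)) (h : ∃ s ∈ T, s.2 ≠ 0) : ℙ ℂ (BlockOps E) :=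
  Projectivization.mk ℂ (blockProj T : BlockOps E)
    (blockProj_ne_zero h.choose_spec.2 h.choose_spec.1)

theorem adj_projVertex {p : ℙ ℂ (BlockOps E)} {T : Set (Σ i, E i)} (h : ∃ s ∈ T, s.2 ≠ 0)
    {x y : Σ i, E i} (hx : x.2 ≠ 0) (hy : y.2 ≠ 0) (hxp : MemCoker p.rep x)
    (hyp : MemTop p.rep y) (hxT : x ∈ T) (hyT : ∀ t ∈ T, BlockOrth t y) :
    (orthograph (BlockOps E)).Adj p (projVertex T h) :=
  (orthograph_adj_mk_right _).2
    ⟨⟨y, hy, hyp, memCoker_blockProj hyT⟩, ⟨x, hx, memTop_blockProj hx hxT, hxp⟩⟩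

theorem projVertex_adj_projVertex {T S : Set (Σ i, E i)} (hT : ∃ s ∈ T, s.2 ≠ 0)
    (hS : ∃ s ∈ S, s.2 ≠ 0) {u v : Σ i, E i} (hu : u.2 ≠ 0) (hv : v.2 ≠ 0) (huT : u ∈ T)
    (hvS : v ∈ S) (huS : ∀ s ∈ S, BlockOrth s u) (hvT : ∀ t ∈ T, BlockOrth t v) :
    (orthograph (BlockOps E)).Adj (projVertex T hT) (projVertex S hS) :=
  (orthograph_adj_mk _ _ _ _).2 ⟨strongBJ_of_memTop hu (memTop_blockProj hu huT)
    (memCoker_blockProj huS), strongBJ_of_memTop hv (memTop_blockProj hv hvS)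
      (memCoker_blockProj hvT)⟩

theorem edist_le_three_or [Nontrivial ι] [∀ i, Nontrivial (E i)]
    (p q : nonisolatedVertices (BlockOps E)) :
    (coreGraph (BlockOps E)).edist p q ≤ 3 ∨ ((coreGraph (BlockOps E)).edist p q ≤ 4 ∧
      ∃ i j : ι, i ≠ j ∧ (∀ l, l = i ∨ l = j) ∧ Module.finrank ℂ (E i) = 2 ∧
        Module.finrank ℂ (E j) = 1) := by
  obtain ⟨x, y, hx, hy, hxp, hyp, hxy⟩ := exists_memTop_memCoker_of_mem p
  obtain ⟨z, w, hz, hw, hzq, hwq, hzw⟩ := exists_memTop_memCoker_of_mem q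
  rcases blockOrth_or_exists_separates hx hy hz hw hxy hzw with
    ⟨hxw, hzy⟩ | ⟨u, v, hu, hv, huy, huz, hvx, hvw, huv⟩ |
    ⟨i, j, hij, hl, hi2, hj1, hxi, hyi, hzi, hwi⟩
  · left
    -- Both `x` and `z` are orthogonal to `y` and `w`, so the projection onto their span is a common
    -- neighbour.
    have hT : ∃ s ∈ ({x, z} : Set (Σ i, E i)), s.2 ≠ 0 := ⟨x, by simp, hx⟩
    refine (edist_coreGraph_le_two
      (adj_projVertex hT hx hy hxp hyp (by simp) ?_)
      (adj_projVertex hT hz hw hzq hwq (by simp) ?_).symm).trans (by norm_num)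
    · rintro t (rfl | rfl) <;> assumption
    · rintro t (rfl | rfl) <;> assumption
  · left
    have hT : ∃ s ∈ ({x, u} : Set (Σ i, E i)), s.2 ≠ 0 := ⟨x, by simp, hx⟩
    have hS : ∃ s ∈ ({z, v} : Set (Σ i, E i)), s.2 ≠ 0 := ⟨z, by simp, hz⟩
    refine edist_coreGraph_le_three
      (adj_projVertex hT hx hy hxp hyp (by simp) ?_)
      (projVertex_adj_projVertex hT hS hu hv (by simp) (by simp) ?_ ?_)
      (adj_projVertex hS hz hw hzq hwq (by simp) ?_).symm
    · rintro t (rfl | rfl) <;> assumption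
    · rintro t (rfl | rfl)
      · exact huz.symm
      · exact huv.symm
    · rintro t (rfl | rfl)
      · exact hvx.symm
      · exact huv
    · rintro t (rfl | rfl) <;> assumption
  · right
    refine ⟨?_, i, j, hij, hl, hi2, hj1⟩
    -- The vector `g` is orthogonal to all four given vectors, so both `{x, g}` and `{z, g}` give
    -- neighbours of the projection onto the span of `y` and `w`.
    obtain ⟨g, hg⟩ := exists_ne (0 : E j)
    have hgo : ∀ t : Σ i, E i, t.1 = i → BlockOrth ⟨j, g⟩ t := fun t ht =>
      blockOrth_of_ne (ht ▸ hij.symm)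
    have hT : ∃ s ∈ ({x, ⟨j, g⟩} : Set (Σ i, E i)), s.2 ≠ 0 := ⟨x, by simp, hx⟩
    have hS : ∃ s ∈ ({z, ⟨j, g⟩} : Set (Σ i, E i)), s.2 ≠ 0 := ⟨z, by simp, hz⟩
    have hR : ∃ s ∈ ({y, w} : Set (Σ i, E i)), s.2 ≠ 0 := ⟨y, by simp, hy⟩
    refine edist_coreGraph_le_four
      (adj_projVertex hT hx hy hxp hyp (by simp) ?_)
      (projVertex_adj_projVertex hT hR (u := ⟨j, g⟩) (v := y) hg hy (by simp) (by simp) ?_ ?_)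
      (projVertex_adj_projVertex hR hS (u := w) (v := ⟨j, g⟩) hw hg (by simp) (by simp) ?_ ?_)
      (adj_projVertex hS hz hw hzq hwq (by simp) ?_).symm
    · rintro t (rfl | rfl)
      exacts [hxy, hgo _ hyi]
    · rintro t (rfl | rfl)
      exacts [(hgo _ hyi).symm, (hgo _ hwi).symm]
    · rintro t (rfl | rfl)
      exacts [hxy, hgo _ hyi]
    · rintro t (rfl | rfl)
      exacts [hzw, hgo _ hwi]
    · rintro t (rfl | rfl)
      exacts [(hgo _ hyi).symm, (hgo _ hwi).symm]
    · rintro t (rfl | rfl)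
      exacts [hzw, hgo _ hwi]

/-! ### Lower bounds for distances between operators with prescribed top and kernel lines. -/

theorem lineOp_mem_nonisolatedVertices {x y : Σ i, E i} (hx : x.2 ≠ 0) (hy : y.2 ≠ 0)
    (hxy : BlockOrth x y) :
    Projectivization.mk ℂ (lineOp x y : BlockOps E) (lineOp_ne_zero hxy hy) ∈
      nonisolatedVertices (BlockOps E) := by
  refine ⟨projVertex {x} ⟨x, rfl, hx⟩, (orthograph_adj_mk _ _ _ _).2
    ⟨strongBJ_of_memTop hy (memTop_lineOp hxy hy) (memCoker_blockProj ?_),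
      strongBJ_of_memTop hx (memTop_blockProj hx rfl) (memCoker_lineOp hxy)⟩⟩
  rintro t rfl
  exact hxy

/-- The vertex of a positive contraction with prescribed top line and prescribed kernel line. -/
noncomputable def lineVertex {x y : Σ i, E i} (hx : x.2 ≠ 0) (hy : y.2 ≠ 0)
    (hxy : BlockOrth x y) : nonisolatedVertices (BlockOps E) :=
  ⟨_, lineOp_mem_nonisolatedVertices hx hy hxy⟩

theorem exists_of_adj_lineVertex {x y : Σ i, E i} {hx : x.2 ≠ 0} {hy : y.2 ≠ 0}
    {hxy : BlockOrth x y} {p : nonisolatedVertices (BlockOps E)}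
    (h : (coreGraph (BlockOps E)).Adj p (lineVertex hx hy hxy)) :
    (∃ s : Σ i, E i, s.2 ≠ 0 ∧ MemTop p.1.rep s ∧ ∀ t, BlockOrth s t ↔ BlockOrth x t) ∧
      ∃ s : Σ i, E i, s.2 ≠ 0 ∧ MemCoker p.1.rep s ∧ ∀ t, BlockOrth s t ↔ BlockOrth y t := by
  obtain ⟨⟨s, hs, h1, h2⟩, ⟨t, ht, h3, h4⟩⟩ := (orthograph_adj_mk_right _).1 h
  exact ⟨⟨s, hs, h1, fun _ => blockOrth_iff_of_mem_blockSpan (h2.mem_blockSpan_of_lineOp hxy) hs⟩,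
    ⟨t, ht, h4, fun _ => blockOrth_iff_of_mem_blockSpan (h3.mem_blockSpan_of_lineOp hxy hy) ht⟩⟩

theorem not_adj_lineVertex {x y z w : Σ i, E i} {hx : x.2 ≠ 0} {hy : y.2 ≠ 0}
    {hxy : BlockOrth x y} {hz : z.2 ≠ 0} {hw : w.2 ≠ 0} {hzw : BlockOrth z w}
    (h : ∃ t, ¬ (BlockOrth y t ↔ BlockOrth z t)) :
    ¬ (coreGraph (BlockOps E)).Adj (lineVertex hx hy hxy) (lineVertex hz hw hzw) := by
  intro hadj
  have h' : MutualStrongBJ (lineOp x y : BlockOps E) (lineOp z w) :=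
    (orthograph_adj_mk _ _ _ _).1 hadj
  obtain ⟨s, hs, h1, h2⟩ := h'.1.exists_memTop (lineOp_ne_zero hxy hy)
  obtain ⟨t, ht⟩ := h
  exact ht ((blockOrth_iff_of_mem_blockSpan (h1.mem_blockSpan_of_lineOp hxy hy) hs).symm.trans
    (blockOrth_iff_of_mem_blockSpan (h2.mem_blockSpan_of_lineOp hzw) hs))

/-- A common neighbour would have `x` as a top vector and `w` as a kernel vector, up to scalars, and
these are orthogonal. -/
theorem not_adj_adj_lineVertex {x y z w : Σ i, E i} {hx : x.2 ≠ 0} {hy : y.2 ≠ 0}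
    {hxy : BlockOrth x y} {hz : z.2 ≠ 0} {hw : w.2 ≠ 0} {hzw : BlockOrth z w}
    (h : ¬ BlockOrth x w) {r : nonisolatedVertices (BlockOps E)}
    (h1 : (coreGraph (BlockOps E)).Adj (lineVertex hx hy hxy) r)
    (h2 : (coreGraph (BlockOps E)).Adj r (lineVertex hz hw hzw)) : False := by
  obtain ⟨⟨s, -, hs1, hs2⟩, -⟩ := exists_of_adj_lineVertex h1.symm
  obtain ⟨-, ⟨t, -, ht1, ht2⟩⟩ := exists_of_adj_lineVertex h2
  have h3 := hs1.blockOrth r.1.rep_nonzero ht1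
  exact h ((ht2 _).1 ((hs2 _).1 h3).symm).symm

/-- The two witnesses of the middle edge serve as `u` and `v`. The outer edges force `x`, `y` to be
top and kernel vectors of `r`, and `z`, `w` those of `s`, up to scalars; `MemTop.blockOrth` gives
the orthogonality relations. -/
theorem exists_separates_of_adj_lineVertex {x y z w : Σ i, E i} {hx : x.2 ≠ 0} {hy : y.2 ≠ 0}
    {hxy : BlockOrth x y} {hz : z.2 ≠ 0} {hw : w.2 ≠ 0} {hzw : BlockOrth z w}
    {r s : nonisolatedVertices (BlockOps E)}
    (h1 : (coreGraph (BlockOps E)).Adj (lineVertex hx hy hxy) r)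
    (h2 : (coreGraph (BlockOps E)).Adj r s)
    (h3 : (coreGraph (BlockOps E)).Adj s (lineVertex hz hw hzw)) :
    ∃ u v, Separates x y z w u v := by
  obtain ⟨⟨x', -, hx1, hx2⟩, ⟨y', -, hy1, hy2⟩⟩ := exists_of_adj_lineVertex h1.symm
  obtain ⟨⟨z', -, hz1, hz2⟩, ⟨w', -, hw1, hw2⟩⟩ := exists_of_adj_lineVertex h3
  obtain ⟨⟨u, hu, hu1, hu2⟩, ⟨v, hv, hv1, hv2⟩⟩ := orthograph_adj_iff.1 h2
  have hr := r.1.rep_nonzero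
  have hs := s.1.rep_nonzero
  exact ⟨u, v, hu, hv, ((hy2 _).1 (hu1.blockOrth hr hy1).symm).symm,
    ((hz2 _).1 (hz1.blockOrth hs hu2)).symm, ((hx2 _).1 (hx1.blockOrth hr hv2)).symm,
    ((hw2 _).1 (hv1.blockOrth hs hw1).symm).symm, hu1.blockOrth hr hv2⟩

theorem lineVertex_ne {x y z w : Σ i, E i} {hx : x.2 ≠ 0} {hy : y.2 ≠ 0}
    {hxy : BlockOrth x y} {hz : z.2 ≠ 0} {hw : w.2 ≠ 0} {hzw : BlockOrth z w}
    (h : ¬ BlockOrth x w) : lineVertex hx hy hxy ≠ lineVertex hz hw hzw := by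
  intro heq
  obtain ⟨r, hr⟩ : ∃ r, (coreGraph (BlockOps E)).Adj (lineVertex hx hy hxy) r := by
    obtain ⟨r, hr⟩ := (lineVertex hx hy hxy).2
    exact ⟨⟨r, _, hr.symm⟩, hr⟩
  have hr' := hr.symm
  rw [heq] at hr'
  exact not_adj_adj_lineVertex h hr hr'

theorem four_le_edist_lineVertex {x y z w : Σ i, E i} {hx : x.2 ≠ 0} {hy : y.2 ≠ 0}
    {hxy : BlockOrth x y} {hz : z.2 ≠ 0} {hw : w.2 ≠ 0} {hzw : BlockOrth z w}
    (h1 : ¬ BlockOrth x w) (h2 : ∃ t, ¬ (BlockOrth y t ↔ BlockOrth z t))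
    (h3 : ¬ ∃ u v, Separates x y z w u v) :
    4 ≤ (coreGraph (BlockOps E)).edist (lineVertex hx hy hxy) (lineVertex hz hw hzw) := by
  by_contra! hlt
  rcases SimpleGraph.exists_of_edist_lt_four hlt with h | h | ⟨r, h, h'⟩ | ⟨r, s, h, h', h''⟩
  · exact lineVertex_ne h1 h
  · exact not_adj_lineVertex h2 h
  · exact not_adj_adj_lineVertex h1 h h'
  · exact h3 (exists_separates_of_adj_lineVertex h h' h'')

theorem three_le_edist_lineVertex {x y z w : Σ i, E i} {hx : x.2 ≠ 0} {hy : y.2 ≠ 0}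
    {hxy : BlockOrth x y} {hz : z.2 ≠ 0} {hw : w.2 ≠ 0} {hzw : BlockOrth z w}
    (h1 : ¬ BlockOrth x w) (h2 : ∃ t, ¬ (BlockOrth y t ↔ BlockOrth z t)) :
    3 ≤ (coreGraph (BlockOps E)).edist (lineVertex hx hy hxy) (lineVertex hz hw hzw) := by
  have : 2 < (coreGraph (BlockOps E)).edist (lineVertex hx hy hxy) (lineVertex hz hw hzw) := by
    refine SimpleGraph.two_lt_edist_iff.2 ⟨lineVertex_ne h1, not_adj_lineVertex h2, ?_⟩
    refine Set.eq_empty_of_forall_notMem fun r hr => ?_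
    rw [SimpleGraph.mem_commonNeighbors] at hr
    exact not_adj_adj_lineVertex h1 hr.1 hr.2.symm
  exact Order.add_one_le_of_lt this

end BlockGraph

/-! ### The diameter for direct sums of operator algebras -/

section Dimension

variable {F : Type*} [NormedAddCommGroup F] [InnerProductSpace ℂ F]

theorem exists_eq_smul_of_inner_eq_zero (h2 : Module.finrank ℂ F = 2) {g u v : F} (hg : g ≠ 0)
    (hu : u ≠ 0) (hgu : inner ℂ g u = 0) (hgv : inner ℂ g v = 0) : ∃ c : ℂ, v = c • u := by
  have : Fact (Module.finrank ℂ F = 1 + 1) := ⟨h2⟩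
  have h1 := Submodule.finrank_orthogonal_span_singleton (𝕜 := ℂ) (n := 1) hg
  have hu' := Submodule.mem_orthogonal_singleton_iff_inner_right.2 hgu
  have hv' := Submodule.mem_orthogonal_singleton_iff_inner_right.2 hgv
  obtain ⟨c, hc⟩ := (finrank_eq_one_iff_of_nonzero' (⟨u, hu'⟩ : (Submodule.span ℂ {g})ᗮ)
    (fun h => hu (congrArg Subtype.val h))).1 h1 ⟨v, hv'⟩
  exact ⟨c, (congrArg Subtype.val hc).symm⟩

theorem exists_forall_apply_eq_smul (h1 : Module.finrank ℂ F = 1) (f : F →L[ℂ] F) :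
    ∃ c : ℂ, ∀ v, f v = c • v := by
  obtain ⟨u, -, hu⟩ := finrank_eq_one_iff'.1 h1
  obtain ⟨c, hc⟩ := hu (f u)
  refine ⟨c, fun v => ?_⟩
  obtain ⟨d, rfl⟩ := hu v
  rw [map_smul, ← hc, smul_comm]

theorem eq_zero_of_star_apply_eq_zero [CompleteSpace F] (h1 : Module.finrank ℂ F = 1)
    {f : F →L[ℂ] F} {v : F} (hv : v ≠ 0) (h : star f v = 0) : f = 0 := by
  obtain ⟨c, hc⟩ := exists_forall_apply_eq_smul h1 (star f)
  have hc0 : c = 0 := by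
    rw [hc] at h
    exact (smul_eq_zero.1 h).resolve_right hv
  rw [← star_eq_zero]
  ext u
  simp [hc, hc0]

end Dimension

section Diameter

variable {ι : Type*} [Fintype ι] {E : ι → Type*} [∀ i, NormedAddCommGroup (E i)]
  [∀ i, InnerProductSpace ℂ (E i)] [∀ i, FiniteDimensional ℂ (E i)] [∀ i, CompleteSpace (E i)]

theorem orthographDiam_blockOps_eq_three [Nontrivial ι] [∀ i, Nontrivial (E i)]
    (h3 : (∃ i, 2 ≤ Module.finrank ℂ (E i)) ∨ ∃ i j l : ι, i ≠ j ∧ i ≠ l ∧ j ≠ l)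
    (h : ¬ ∃ i j : ι, i ≠ j ∧ (∀ l, l = i ∨ l = j) ∧ Module.finrank ℂ (E i) = 2 ∧
      Module.finrank ℂ (E j) = 1) : orthographDiam (BlockOps E) = 3 := by
  apply le_antisymm
  · refine SimpleGraph.ediam_le_of_edist_le fun p q => ?_
    exact (edist_le_three_or p q).resolve_right fun h' => h h'.2
  -- The total dimension is at least three, which leaves room for three mutually orthogonal block
  -- vectors.
  · obtain ⟨x, y, z, hx, hy, hz, hxy, hzx, hyz⟩ : ∃ x y z : Σ i, E i, x.2 ≠ 0 ∧ y.2 ≠ 0 ∧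
        z.2 ≠ 0 ∧ BlockOrth x y ∧ BlockOrth z x ∧ BlockOrth y z := by
      choose e he using fun j => exists_ne (0 : E j)
      rcases h3 with ⟨i, hi⟩ | ⟨i, j, l, hij, hil, hjl⟩
      · obtain ⟨j, hj⟩ := exists_ne i
        obtain ⟨u, hu, hu1⟩ := exists_ne_zero_orthogonal {e i} (by rwa [Finset.card_singleton])
        exact ⟨⟨i, e i⟩, ⟨i, u⟩, ⟨j, e j⟩, he i, hu, he j,
          (blockOrth_mk.2 (hu1 _ (by simp))).symm, blockOrth_of_ne hj, blockOrth_of_ne hj.symm⟩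
      · exact ⟨⟨i, e i⟩, ⟨j, e j⟩, ⟨l, e l⟩, he i, he j, he l, blockOrth_of_ne hij,
          blockOrth_of_ne hil.symm, blockOrth_of_ne hjl⟩
    -- the two test pairs share the kernel line of one and the top line of the other
    refine (three_le_edist_lineVertex (hx := hx) (hy := hy) (hxy := hxy) (hz := hz) (hw := hx)
      (hzw := hzx) (not_blockOrth_self hx) ⟨y, ?_⟩).trans SimpleGraph.edist_le_ediam
    exact fun h => not_blockOrth_self hy (h.2 hyz.symm)

theorem orthographDiam_blockOps_eq_four [Nontrivial ι] [∀ i, Nontrivial (E i)]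
    {i j : ι} (hij : i ≠ j) (hl : ∀ l, l = i ∨ l = j) (hi : Module.finrank ℂ (E i) = 2)
    (hj : Module.finrank ℂ (E j) = 1) : orthographDiam (BlockOps E) = 4 := by
  apply le_antisymm
  · refine SimpleGraph.ediam_le_of_edist_le fun p q => ?_
    rcases edist_le_three_or p q with h | h
    · exact h.trans (by norm_num)
    · exact h.1
  · obtain ⟨y, hy⟩ := exists_ne (0 : E i)
    obtain ⟨x, hx, hxy⟩ := exists_ne_zero_orthogonal {y} (by simp [hi])
    replace hxy : inner ℂ x y = 0 := hxy y (by simp)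
    have hyx : inner ℂ y x = 0 := inner_eq_zero_symm.1 hxy
    have hxw : inner ℂ x (y + x) ≠ 0 := by
      rw [inner_add_right, hxy, zero_add]
      exact inner_self_ne_zero.2 hx
    have hyw : inner ℂ y (y + x) ≠ 0 := by
      rw [inner_add_right, hyx, add_zero]
      exact inner_self_ne_zero.2 hy
    -- Only the obliqueness of `w` to both `x` and `y` matters from here on.
    generalize y + x = w at hxw hyw
    have hw : w ≠ 0 := by
      rintro rfl
      exact hxw (inner_zero_right _)
    obtain ⟨z, hz, hzw⟩ := exists_ne_zero_orthogonal {w} (by simp [hi])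
    replace hzw : inner ℂ z w = 0 := hzw w (by simp)
    refine (four_le_edist_lineVertex (x := ⟨i, x⟩) (y := ⟨i, y⟩) (z := ⟨i, z⟩) (w := ⟨i, w⟩)
      (hx := hx) (hy := hy) (hxy := blockOrth_mk.2 hxy) (hz := hz) (hw := hw)
      (hzw := blockOrth_mk.2 hzw) (fun h => hxw (blockOrth_mk.1 h))
      ⟨⟨i, w⟩, fun h => hyw (blockOrth_mk.1 (h.2 (blockOrth_mk.2 hzw)))⟩ ?_).trans
        SimpleGraph.edist_le_ediam
    rintro ⟨⟨k, u⟩, ⟨m, v⟩, hu, hv, huy, huz, hvx, hvw, huv⟩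
    -- In the plane, `u ⊥ z` would make `w` a multiple of `u`, contradicting `u ⊥ y`; likewise `v ⊥
    -- x` would make `y` a multiple of `v`, contradicting `v ⊥ w`. So both lie in the
    -- one-dimensional block, where they cannot be orthogonal.
    rcases hl k with rfl | rfl
    · have huy := inner_eq_zero_symm.1 (blockOrth_mk.1 huy)
      have huz := inner_eq_zero_symm.1 (blockOrth_mk.1 huz)
      obtain ⟨c, rfl⟩ := exists_eq_smul_of_inner_eq_zero hi hz hu huz hzw
      rw [inner_smul_right, huy, mul_zero] at hyw
      exact hyw rfl
    · rcases hl m with rfl | rfl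
      · have hvx := inner_eq_zero_symm.1 (blockOrth_mk.1 hvx)
        have hvw := inner_eq_zero_symm.1 (blockOrth_mk.1 hvw)
        obtain ⟨c, rfl⟩ := exists_eq_smul_of_inner_eq_zero hi hx hv hvx hxy
        rw [inner_smul_left, inner_eq_zero_symm.1 hvw, mul_zero] at hyw
        exact hyw rfl
      · have h2 : 2 ≤ Module.finrank ℂ (E m) :=
          two_le_finrank_of_inner_eq_zero hu hv (blockOrth_mk.1 huv)
        omega

/-- On one-dimensional blocks operators are scalars, so a kernel vector makes a whole component
vanish. A non-isolated vertex is therefore supported on one block: two with the same block coincide,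
two with different blocks are adjacent. -/
theorem orthographDiam_blockOps_eq_one {i j : ι} (hij : i ≠ j) (hl : ∀ l, l = i ∨ l = j)
    (h1 : ∀ l, Module.finrank ℂ (E l) = 1) : orthographDiam (BlockOps E) = 1 := by
  have hnt : ∀ l, Nontrivial (E l) := fun l =>
    Module.nontrivial_of_finrank_pos (R := ℂ) (by simp [h1 l])
  have hcov : ∀ a b : ι, a ≠ b → ∀ c, c = a ∨ c = b := by
    intro a b hab c
    have ha := hl a
    have hb := hl b
    have hc := hl c
    grind
  have hne : ∀ s t : Σ i, E i, s.2 ≠ 0 → t.2 ≠ 0 → BlockOrth s t → s.1 ≠ t.1 := by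
    rintro ⟨k, u⟩ ⟨m, v⟩ hu hv h (rfl : k = m)
    have h2 : 2 ≤ Module.finrank ℂ (E k) :=
      two_le_finrank_of_inner_eq_zero hu hv (blockOrth_mk.1 h)
    have := h1 k
    omega
  choose e he using fun j => exists_ne (0 : E j)
  have hTi : ∃ s ∈ ({⟨i, e i⟩} : Set (Σ i, E i)), s.2 ≠ 0 := ⟨_, rfl, he i⟩
  have hTj : ∃ s ∈ ({⟨j, e j⟩} : Set (Σ i, E i)), s.2 ≠ 0 := ⟨_, rfl, he j⟩
  have hadj : (orthograph (BlockOps E)).Adj (projVertex _ hTi) (projVertex _ hTj) := by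
    refine projVertex_adj_projVertex hTi hTj (u := ⟨i, e i⟩) (v := ⟨j, e j⟩) (he i) (he j) rfl rfl
      ?_ ?_
    · rintro s rfl
      exact blockOrth_of_ne hij.symm
    · rintro s rfl
      exact blockOrth_of_ne hij
  have hnon : Nontrivial (nonisolatedVertices (BlockOps E)) :=
    ⟨⟨_, _, hadj⟩, ⟨_, _, hadj.symm⟩, fun h => hadj.ne (congrArg Subtype.val h)⟩
  refine SimpleGraph.ediam_eq_one.2 (SimpleGraph.eq_top_iff_forall_ne_adj.2 fun p q hpq => ?_)
  obtain ⟨x, y, hx, hy, hxp, hyp, hxy⟩ := exists_memTop_memCoker_of_mem p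
  obtain ⟨z, w, hz, hw, hzq, hwq, hzw⟩ := exists_memTop_memCoker_of_mem q
  have hxy' := hne _ _ hx hy hxy
  have hzw' := hne _ _ hz hw hzw
  have hpx : p.1.rep x.1 = 0 := eq_zero_of_star_apply_eq_zero (h1 _) hx hxp
  have hqz : q.1.rep z.1 = 0 := eq_zero_of_star_apply_eq_zero (h1 _) hz hzq
  by_cases hyw : y.1 = w.1
  · exfalso
    have hxz : x.1 = z.1 := (hcov y.1 x.1 hxy'.symm z.1).elim
      (fun h => absurd (h.trans hyw) hzw') Eq.symm
    have hall := hcov x.1 y.1 hxy'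
    obtain ⟨c, hc⟩ := exists_forall_apply_eq_smul (h1 _) (p.1.rep y.1)
    obtain ⟨d, hd⟩ := exists_forall_apply_eq_smul (h1 _) (q.1.rep y.1)
    have hd0 : d ≠ 0 := by
      rintro rfl
      refine q.1.rep_nonzero (funext fun l => ?_)
      rcases hall l with rfl | rfl
      · rw [hxz, hqz]
        rfl
      · ext v
        simp [hd]
    refine hpq (Subtype.ext ?_)
    rw [← p.1.mk_rep, ← q.1.mk_rep, Projectivization.mk_eq_mk_iff']
    refine ⟨c / d, funext fun l => ?_⟩
    rcases hall l with rfl | rfl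
    · rw [Pi.smul_apply, hpx, hxz, hqz, smul_zero]
    · ext v
      rw [Pi.smul_apply, smul_apply, hc, hd, smul_smul, div_mul_cancel₀ _ hd0]
  · have hyz : y.1 = z.1 := (hcov w.1 z.1 hzw'.symm y.1).resolve_left hyw
    have hwx : w.1 = x.1 := (hcov y.1 x.1 hxy'.symm w.1).resolve_left (Ne.symm hyw)
    have hqy : q.1.rep y.1 = 0 := hyz ▸ hqz
    have hpw : p.1.rep w.1 = 0 := hwx ▸ hpx
    refine orthograph_adj_iff.2 ⟨⟨y, hy, hyp, ?_⟩, ⟨w, hw, hwq, ?_⟩⟩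
    · change star (q.1.rep y.1) y.2 = 0
      rw [hqy, star_zero, zero_apply]
    · change star (p.1.rep w.1) w.2 = 0
      rw [hpw, star_zero, zero_apply]

end Diameter

/-! ### Direct sums of full matrix algebras -/

theorem nonempty_starAlgEquiv_prod {ι : Type*} {R : ι → Type*} [∀ i, Ring (R i)]
    [∀ i, Algebra ℂ (R i)] [∀ i, StarRing (R i)] {B C : Type*} [Ring B] [Algebra ℂ B] [StarRing B]
    [Ring C] [Algebra ℂ C] [StarRing C] {i j : ι} (hij : i ≠ j) (hl : ∀ l, l = i ∨ l = j)
    (f : R i ≃⋆ₐ[ℂ] B) (g : R j ≃⋆ₐ[ℂ] C) : Nonempty ((∀ l, R l) ≃⋆ₐ[ℂ] C × B) := by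
  classical
  let φ : (∀ l, R l) →⋆ₐ[ℂ] C × B :=
    (g.toStarAlgHom.comp (Pi.evalStarAlgHom ℂ R j)).prod
      (f.toStarAlgHom.comp (Pi.evalStarAlgHom ℂ R i))
  have hφ : ∀ a, φ a = (g (a j), f (a i)) := fun _ => rfl
  refine ⟨StarAlgEquiv.ofBijective φ ⟨fun a b h => funext fun l => ?_, fun c => ?_⟩⟩
  · rw [hφ, hφ, Prod.mk.injEq] at h
    rcases hl l with rfl | rfl
    · exact EquivLike.injective f h.2
    · exact EquivLike.injective g h.1
  · refine ⟨Pi.single i (f.symm c.2) + Pi.single j (g.symm c.1), ?_⟩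
    rw [hφ]
    simp [hij, hij.symm]

theorem nonempty_matrix_starAlgEquiv_complex {m : ℕ} (hm : m = 1) :
    Nonempty (Matrix (Fin m) (Fin m) ℂ ≃⋆ₐ[ℂ] ℂ) := by
  subst hm
  exact ⟨{
    toFun := fun x => x 0 0
    invFun := fun c => Matrix.of fun _ _ => c
    left_inv := fun x => by
      ext i j
      rw [Subsingleton.elim i 0, Subsingleton.elim j 0]
      rfl
    right_inv := fun _ => rfl
    map_mul' := fun x y => by simp [Matrix.mul_apply]
    map_add' := fun _ _ => rfl
    map_star' := fun _ => rfl
    map_smul' := fun _ _ => rfl }⟩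

/-- A direct sum of full matrix algebras as a direct sum of algebras of operators. -/
noncomputable def piMatrixStarAlgEquiv {ι : Type*} (n : ι → ℕ) :
    ((i : ι) → Matrix (Fin (n i)) (Fin (n i)) ℂ) ≃⋆ₐ[ℂ]
      BlockOps fun i => EuclideanSpace ℂ (Fin (n i)) :=
  StarAlgEquiv.ofAlgEquiv
    (AlgEquiv.piCongrRight fun i =>
      (Matrix.toEuclideanCLM (n := Fin (n i)) (𝕜 := ℂ)).toAlgEquiv)
    fun x => funext fun i => map_star (Matrix.toEuclideanCLM (n := Fin (n i)) (𝕜 := ℂ)) (x i)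

theorem orthographDiam_eq_blockOps {ι : Type*} [Fintype ι] {A : Type*} [CStarAlgebra A]
    {n : ι → ℕ} (e : A ≃⋆ₐ[ℂ] ((i : ι) → Matrix (Fin (n i)) (Fin (n i)) ℂ)) :
    orthographDiam A = orthographDiam (BlockOps fun i => EuclideanSpace ℂ (Fin (n i))) :=
  orthographDiam_congr (e.trans (piMatrixStarAlgEquiv n))

theorem mainTheorem1 {A : Type*} [CStarAlgebra A] (k : ℕ) (hk : 2 ≤ k) (n : Fin k → ℕ)
    (hn : ∀ i, 1 ≤ n i) (e : A ≃⋆ₐ[ℂ] ((i : Fin k) → Matrix (Fin (n i)) (Fin (n i)) ℂ)) :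
    (Nonempty (A ≃⋆ₐ[ℂ] ℂ × ℂ) → orthographDiam A = 1) ∧
    (Nonempty (A ≃⋆ₐ[ℂ] ℂ × Matrix (Fin 2) (Fin 2) ℂ) → orthographDiam A = 4) ∧
    (¬ Nonempty (A ≃⋆ₐ[ℂ] ℂ × ℂ) → ¬ Nonempty (A ≃⋆ₐ[ℂ] ℂ × Matrix (Fin 2) (Fin 2) ℂ) →
      orthographDiam A = 3) := by
  have hfin : ∀ l : Fin 2, l = 0 ∨ l = 1 := by decide
  refine ⟨?_, ?_, ?_⟩
  · rintro ⟨f⟩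
    let m : Fin 2 → ℕ := fun _ => 1
    obtain ⟨φ⟩ := nonempty_matrix_starAlgEquiv_complex rfl
    obtain ⟨g⟩ := nonempty_starAlgEquiv_prod (R := fun l => Matrix (Fin (m l)) (Fin (m l)) ℂ)
      zero_ne_one hfin φ φ
    rw [orthographDiam_eq_blockOps (f.trans g.symm)]
    exact orthographDiam_blockOps_eq_one zero_ne_one hfin fun l => by simp [m]
  · rintro ⟨f⟩
    let m : Fin 2 → ℕ := ![2, 1]
    obtain ⟨φ⟩ := nonempty_matrix_starAlgEquiv_complex rfl
    obtain ⟨g⟩ := nonempty_starAlgEquiv_prod (R := fun l => Matrix (Fin (m l)) (Fin (m l)) ℂ)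
      (B := Matrix (Fin 2) (Fin 2) ℂ) zero_ne_one hfin (StarAlgEquiv.refl ℂ _) φ
    have hm : ∀ l, Nontrivial (EuclideanSpace ℂ (Fin (m l))) := fun l =>
      Module.nontrivial_of_finrank_pos (R := ℂ) (by
        rw [finrank_euclideanSpace_fin]
        rcases hfin l with rfl | rfl <;> simp [m])
    rw [orthographDiam_eq_blockOps (f.trans g.symm)]
    exact orthographDiam_blockOps_eq_four zero_ne_one hfin finrank_euclideanSpace_fin
      finrank_euclideanSpace_fin
  · intro hA1 hA2
    have hι : Nontrivial (Fin k) := Fin.nontrivial_iff_two_le.2 hk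
    have hE : ∀ l, Nontrivial (EuclideanSpace ℂ (Fin (n l))) := fun l =>
      Module.nontrivial_of_finrank_pos (R := ℂ) (by
        rw [finrank_euclideanSpace_fin]
        exact hn l)
    rw [orthographDiam_eq_blockOps e]
    refine orthographDiam_blockOps_eq_three ?_ ?_
    · simp only [finrank_euclideanSpace, Fintype.card_fin]
      -- Otherwise every block has size one and there are no three distinct blocks, so `A` would be
      -- `ℂ × ℂ`.
      by_contra! h
      obtain ⟨h2, h3⟩ := h
      have h1 : ∀ l, n l = 1 := fun l => by
        have := hn l
        have := h2 l
        omega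
      obtain ⟨i, j, hij⟩ := exists_pair_ne (Fin k)
      obtain ⟨φ⟩ := nonempty_matrix_starAlgEquiv_complex (h1 i)
      obtain ⟨ψ⟩ := nonempty_matrix_starAlgEquiv_complex (h1 j)
      obtain ⟨g⟩ := nonempty_starAlgEquiv_prod (R := fun l => Matrix (Fin (n l)) (Fin (n l)) ℂ)
        hij (fun l => by
          by_cases hl : i = l
          · exact Or.inl hl.symm
          · exact Or.inr (h3 i j l hij hl).symm) φ ψ
      exact hA1 ⟨e.trans g⟩
    · simp only [finrank_euclideanSpace, Fintype.card_fin]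
      rintro ⟨i, j, hij, hl, hi, hj⟩
      obtain ⟨φ⟩ : Nonempty (Matrix (Fin (n i)) (Fin (n i)) ℂ ≃⋆ₐ[ℂ] Matrix (Fin 2) (Fin 2) ℂ) := by
        rw [hi]
        exact ⟨StarAlgEquiv.refl ℂ _⟩
      obtain ⟨ψ⟩ := nonempty_matrix_starAlgEquiv_complex hj
      obtain ⟨g⟩ := nonempty_starAlgEquiv_prod (R := fun l => Matrix (Fin (n l)) (Fin (n l)) ℂ)
        hij hl φ ψ
      exact hA2 ⟨e.trans g⟩
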